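/- Let $F:\mathbb{R}^n\rightrightarrows\mathbb{R}^q$ be a polyhedral convex set-valued mapping, that is, its graph $\operatorname{gr}F=\{(x,y) : y\in F(x)\}$ is a convex polyhedron, and let $\operatorname{dom}F=\{x : F(x)\neq\emptyset\}$. Let $G:\mathbb{R}^n\rightrightarrows\mathbb{R}^q$ be the recession mapping of $F$, whose graph is the recession cone of $\operatorname{gr}F$. Let $C\subseteq\mathbb{R}^q$ be a nonempty polyhedral convex cone which is regular for $F$, i.e. $C\cap(-C)\subseteq G(0)\subseteq C$. Consider the problem $$\text{(P)}\qquad \min F(x)+C\quad\text{s.t. } x\in\mathbb{R}^n ,$$ where minimization is with respect to $\supseteq$; (P) is feasible if $\operatorname{dom}F\neq\emptyset$. A solution of (P) is a pair $(\bar S,\hat S)$ of finite sets $\emptyset\neq\bar S\subseteq\operatorname{dom}F$ and $\hat S\subseteq\operatorname{dom}G\setminus\{0\}$ such that $$C+\bigcup_{x\in\mathbb{R}^n}F(x)\ \subseteq\ C+\operatorname{conv}\bigcup_{x\in\bar S}F(x)+\operatorname{cone}\bigcup_{x\in\hat S}G(x)$$ (where $\operatorname{cone}Y$ is the smallest convex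 cone containing $Y\cup\{0\}$), for no $\bar x\in\bar S$ there is $x\in\mathbb{R}^n$ with $F(x)+C\supsetneq F(\bar x)+C$, and for no $\hat x\in\hat S$ there is $x\in\mathbb{R}^n$ with $G(x)+C\supsetneq G(\hat x)+C$. Let $Q=C+\bigcup_{x\in\mathbb{R}^n}G(x)$ be the upper image of the homogeneous problem $\min G(x)+C$ s.t. $x\in\mathbb{R}^n$, and let $K=\{y\in\mathbb{R}^q : \exists x\in\mathbb{R}^n,\ y\in G(x),\ 0\in G(x)\}$ be the natural ordering cone of $F$. Then (P) has a solution if and only if (P) is feasible, $(-C)\cap Q\subseteq C$, and $C\supseteq K$. -/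

import Mathlib

open scoped Pointwise

namespace SetOpt

/-- A convex polyhedron in a real vector space: the solution set of a finite system of
(non-strict, possibly inhomogeneous) linear inequalities. -/
def IsConvexPolyhedron {E : Type*} [AddCommGroup E] [Module ℝ E] (S : Set E) : Prop :=
  ∃ (m : ℕ) (f : Fin m → (E →ₗ[ℝ] ℝ)) (b : Fin m → ℝ), S = {z | ∀ i, b i ≤ f i z}

/-- A (nonempty) polyhedral convex cone: the solution set of a finite system of homogeneous
linear inequalities. -/
def IsPolyhedralConvexCone {E : Type*} [AddCommGroup E] [Module ℝ E] (S : Set E) : Prop :=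
  ∃ (m : ℕ) (f : Fin m → (E →ₗ[ℝ] ℝ)), S = {z | ∀ i, 0 ≤ f i z}

/-- The recession cone `0⁺ A` of a convex set `A`. -/
def recessionCone {E : Type*} [AddCommGroup E] [Module ℝ E] (A : Set E) : Set E :=
  {d | ∀ z ∈ A, ∀ t : ℝ, 0 ≤ t → z + t • d ∈ A}

/-- The lineality space `C ∩ (-C)` of a convex cone `C`. -/
def lin {E : Type*} [AddCommGroup E] (C : Set E) : Set E := C ∩ -C

variable {n q : ℕ}

/-- The graph of a set-valued mapping. -/
def graph (F : (Fin n → ℝ) → Set (Fin q → ℝ)) : Set ((Fin n → ℝ) × (Fin q → ℝ)) :=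
  {p | p.2 ∈ F p.1}

/-- The domain of a set-valued mapping. -/
def dom (F : (Fin n → ℝ) → Set (Fin q → ℝ)) : Set (Fin n → ℝ) :=
  {x | (F x).Nonempty}

/-- A set-valued mapping is polyhedral convex if its graph is a convex polyhedron. -/
def IsPolyhedralConvexMap (F : (Fin n → ℝ) → Set (Fin q → ℝ)) : Prop :=
  IsConvexPolyhedron (graph F)

/-- The recession mapping `G` of `F`: its graph is the recession cone of the graph of `F`. -/
def recessionMap (F : (Fin n → ℝ) → Set (Fin q → ℝ)) : (Fin n → ℝ) → Set (Fin q → ℝ) :=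
  fun x => {y | (x, y) ∈ recessionCone (graph F)}

/-- The upper image `C + ⋃ₓ H(x)` of the problem of minimizing `H(x) + C`. -/
def upperImage (H : (Fin n → ℝ) → Set (Fin q → ℝ)) (C : Set (Fin q → ℝ)) :
    Set (Fin q → ℝ) :=
  C + ⋃ x, H x

/-- `C` is regular for `F`: `lin C ⊆ G(0) ⊆ C`, where `G` is the recession mapping of `F`. -/
def IsRegular (F : (Fin n → ℝ) → Set (Fin q → ℝ)) (C : Set (Fin q → ℝ)) : Prop :=
  lin C ⊆ recessionMap F 0 ∧ recessionMap F 0 ⊆ C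

/-- The natural ordering cone of `F`: all `y` with `y ∈ G(x)` and `0 ∈ G(x)` for some `x`. -/
def naturalOrderingCone (F : (Fin n → ℝ) → Set (Fin q → ℝ)) : Set (Fin q → ℝ) :=
  {y | ∃ x, y ∈ recessionMap F x ∧ 0 ∈ recessionMap F x}

/-- The problem of minimizing `F(x) + C` is feasible if `F` has a nonempty value. -/
def IsFeasible (F : (Fin n → ℝ) → Set (Fin q → ℝ)) : Prop := (dom F).Nonempty

/-- Finite infimizers. `PointedCone.hull ℝ Y` is the smallest convex cone containing `Y` and
the origin; it is `{0}` for `Y = ∅`. -/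
structure IsFiniteInfimizer (F : (Fin n → ℝ) → Set (Fin q → ℝ)) (C : Set (Fin q → ℝ))
    (Sbar Shat : Set (Fin n → ℝ)) : Prop where
  finite_points : Sbar.Finite
  finite_directions : Shat.Finite
  points_subset : Sbar ⊆ dom F
  points_nonempty : Sbar.Nonempty
  directions_subset : Shat ⊆ dom (recessionMap F) \ {0}
  upperImage_subset : upperImage F C ⊆
    C + convexHull ℝ (⋃ x ∈ Sbar, F x) +
      (PointedCone.hull ℝ (⋃ x ∈ Shat, recessionMap F x) : Set (Fin q → ℝ))

/-- Minimizing points. -/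
def IsMinimizingPoint (F : (Fin n → ℝ) → Set (Fin q → ℝ)) (C : Set (Fin q → ℝ))
    (xbar : Fin n → ℝ) : Prop :=
  xbar ∈ dom F ∧ ¬ ∃ x, F xbar + C ⊂ F x + C

/-- Minimizing directions. -/
def IsMinimizingDirection (F : (Fin n → ℝ) → Set (Fin q → ℝ)) (C : Set (Fin q → ℝ))
    (xhat : Fin n → ℝ) : Prop :=
  xhat ≠ 0 ∧ xhat ∈ dom (recessionMap F) ∧
    ¬ ∃ x, recessionMap F xhat + C ⊂ recessionMap F x + C

/-- A solution is a finite infimizer that consists of minimizing points and minimizing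
directions. -/
def IsSolution (F : (Fin n → ℝ) → Set (Fin q → ℝ)) (C : Set (Fin q → ℝ))
    (Sbar Shat : Set (Fin n → ℝ)) : Prop :=
  IsFiniteInfimizer F C Sbar Shat ∧
    (∀ x ∈ Sbar, IsMinimizingPoint F C x) ∧ (∀ x ∈ Shat, IsMinimizingDirection F C x)

/-- The problem of minimizing `F(x) + C` over `x` has a solution. -/
def HasSolution (F : (Fin n → ℝ) → Set (Fin q → ℝ)) (C : Set (Fin q → ℝ)) : Prop :=
  ∃ Sbar Shat : Set (Fin n → ℝ), IsSolution F C Sbar Shat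

end SetOpt

/-! Write `G` for the recession mapping. Both sides of the equivalence amount to feasibility
together with (*): `G u ⊆ C` whenever `0 ∈ G u + C`.

Solution implies (*): if `0 ∈ G u + C`, moving a minimizing point `xbar` along `u` only enlarges `F
xbar + C`, so by maximality it stays the same. Hence `F xbar + C` contains a ray in each direction
`y ∈ G u`. Functionals defining `C` are bounded below on `F xbar + C`, because `G 0 ⊆ C`, so `y ∈ C`
(`IsMinimizingPoint.mem_of_zero_mem`).

(*) implies solution: a linear program, bounded by (*), places each value of `F + C` or `G + C`
inside a maximal one (`exists_maximal_value`). Applying this to the finitely many generators of the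
homogenized graph gives a solution (`hasSolution_of_forall_mem`).

(*) and the two cone conditions: if `g ∈ G u` and `-g ∈ C`, the condition on the upper image gives
`g ∈ C`. Regularity then puts `-g` in `G 0`, so `0 ∈ G u` and `G u` lies in the natural ordering
cone. -/

namespace PointedCone

open Module

/-! ### Polyhedral cones: Minkowski–Weyl and attainment in linear programs. -/

variable {E E' : Type*} [AddCommGroup E] [Module ℝ E] [AddCommGroup E'] [Module ℝ E']

/-- Fourier-Motzkin elimination of one nonnegative variable. -/
theorem exists_finset_iff_exists_sub_smul (s : Finset (Dual ℝ E)) (v : E) :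
    ∃ t : Finset (Dual ℝ E), ∀ z, (∀ g ∈ t, 0 ≤ g z) ↔
      ∃ r : ℝ, 0 ≤ r ∧ ∀ f ∈ s, 0 ≤ f (z - r • v) := by
  classical
  refine ⟨s.filter (fun f => 0 ≤ f v) ∪
    (s.filter (fun f => 0 < f v) ×ˢ s.filter (fun f => f v < 0)).image
      (fun p => p.1 v • p.2 - p.2 v • p.1), fun z => ⟨fun h => ?_, ?_⟩⟩
  · have hpos : ∀ f ∈ s, 0 ≤ f v → 0 ≤ f z := fun f hf hfv =>
      h f (Finset.mem_union_left _ (Finset.mem_filter.2 ⟨hf, hfv⟩))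
    have hpair : ∀ f ∈ s, ∀ g ∈ s, 0 < f v → g v < 0 → 0 ≤ f v * g z - g v * f z := by
      intro f hf g hg hfv hgv
      have := h (f v • g - g v • f) (Finset.mem_union_right _ (Finset.mem_image.2 ⟨(f, g),
        Finset.mem_product.2 ⟨Finset.mem_filter.2 ⟨hf, hfv⟩, Finset.mem_filter.2 ⟨hg, hgv⟩⟩, rfl⟩))
      simpa using this
    -- Functionals negative at `v` bound `r` below, positive ones bound it above. The largest lower
    -- bound, clipped at 0, works: the pairwise inequalities keep it under every upper bound.
    have key : ∃ r : ℝ, 0 ≤ r ∧ (∀ f ∈ s, f v < 0 → f z / f v ≤ r) ∧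
        ∀ f ∈ s, 0 < f v → r * f v ≤ f z := by
      rcases (s.filter (fun f => f v < 0)).eq_empty_or_nonempty with he | hne
      · refine ⟨0, le_rfl, fun f hf hfv => ?_, fun f hf hfv => by simpa using hpos f hf hfv.le⟩
        have : f ∈ s.filter (fun f => f v < 0) := Finset.mem_filter.2 ⟨hf, hfv⟩
        simp [he] at this
      · obtain ⟨g, hg, hmax⟩ := Finset.exists_max_image _ (fun g : Dual ℝ E => g z / g v) hne
        obtain ⟨hgs, hgv⟩ := Finset.mem_filter.1 hg
        refine ⟨max 0 (g z / g v), le_max_left _ _, fun f hf hfv => le_max_of_le_right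
          (hmax f (Finset.mem_filter.2 ⟨hf, hfv⟩)), fun f hf hfv => ?_⟩
        rcases max_cases (0 : ℝ) (g z / g v) with ⟨h1, -⟩ | ⟨h1, -⟩
        · rw [h1, zero_mul]; exact hpos f hf hfv.le
        · rw [h1, div_mul_eq_mul_div, div_le_iff_of_neg hgv]
          linarith [hpair f hf g hgs hfv hgv]
    obtain ⟨r, hr, hneg, hp⟩ := key
    refine ⟨r, hr, fun f hf => ?_⟩
    rw [map_sub, map_smul, smul_eq_mul, sub_nonneg]
    rcases lt_trichotomy (f v) 0 with hfv | hfv | hfv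
    · have := hneg f hf hfv
      rwa [div_le_iff_of_neg hfv] at this
    · rw [hfv, mul_zero]; exact hpos f hf hfv.ge
    · exact hp f hf hfv
  · rintro ⟨r, hr, h⟩ g hg
    simp only [map_sub, map_smul, smul_eq_mul] at h
    rcases Finset.mem_union.1 hg with hg | hg
    · obtain ⟨hgs, hgv⟩ := Finset.mem_filter.1 hg
      nlinarith [h g hgs]
    · obtain ⟨⟨f, g⟩, hfg, rfl⟩ := Finset.mem_image.1 hg
      obtain ⟨hf, hg⟩ := Finset.mem_product.1 hfg
      obtain ⟨hfs, hfv⟩ := Finset.mem_filter.1 hf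
      obtain ⟨hgs, hgv⟩ := Finset.mem_filter.1 hg
      have h1 := mul_nonneg hfv.le (h g hgs)
      have h2 := mul_nonneg (neg_nonneg.2 hgv.le) (h f hfs)
      simp only [LinearMap.sub_apply, LinearMap.smul_apply, smul_eq_mul]
      linarith

theorem DualFG.bot [FiniteDimensional ℝ E] : DualFG (LinearMap.id (M := Dual ℝ E)) ⊥ := by
  classical
  let b := Module.finBasis ℝ E
  refine ⟨Finset.univ.image (fun i => b.coord i) ∪ Finset.univ.image (fun i => -b.coord i), ?_⟩
  ext z
  simp only [mem_dual, LinearMap.id_apply, Submodule.mem_bot]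
  refine ⟨fun h => b.ext_elem fun i => ?_, fun h => by simp [h]⟩
  have h1 : 0 ≤ b.coord i z := h (by simp)
  have h2 : 0 ≤ (-b.coord i) z := h (by simp)
  simp only [LinearMap.neg_apply, Basis.coord_apply] at h1 h2
  simp only [map_zero, Finsupp.coe_zero, Pi.zero_apply]
  linarith

/-- Weyl's theorem: finitely generated cones are polyhedral. -/
theorem FG.dualFG [FiniteDimensional ℝ E] {C : PointedCone ℝ E} (hC : C.FG) :
    C.DualFG (LinearMap.id (M := Dual ℝ E)) := by
  classical
  obtain ⟨s, rfl⟩ := hC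
  induction s using Finset.induction_on with
  | empty => simpa using DualFG.bot
  | insert v s _ ih =>
    obtain ⟨t, ht⟩ := ih
    obtain ⟨t', ht'⟩ := exists_finset_iff_exists_sub_smul t v
    refine ⟨t', ?_⟩
    ext z
    have h1 : z ∈ dual (LinearMap.id (M := Dual ℝ E)) (t' : Set (Dual ℝ E)) ↔
      ∀ g ∈ t', 0 ≤ g z := Iff.rfl
    have h2 : ∀ z, z ∈ Submodule.span {c : ℝ // 0 ≤ c} (s : Set E) ↔ ∀ g ∈ t, 0 ≤ g z := by
      intro z; rw [← ht]; exact Iff.rfl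
    rw [h1, ht', Finset.coe_insert, Submodule.mem_span_insert]
    constructor
    · rintro ⟨r, hr, h⟩
      exact ⟨⟨r, hr⟩, z - r • v, (h2 _).2 h, by
        rw [show (⟨r, hr⟩ : {c : ℝ // 0 ≤ c}) • v = r • v from rfl]; abel⟩
    · rintro ⟨r, w, hw, rfl⟩
      refine ⟨r, r.2, ?_⟩
      rw [show r • v + w - (r : ℝ) • v = w by
        rw [show r • v = (r : ℝ) • v from rfl]; abel]
      exact (h2 _).1 hw

/-- Minkowski's theorem: polyhedral cones are finitely generated. -/
theorem DualFG.fg [FiniteDimensional ℝ E] {C : PointedCone ℝ E}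
    (hC : C.DualFG (LinearMap.id (M := Dual ℝ E))) : C.FG := by
  classical
  obtain ⟨s, rfl⟩ := hC
  -- Weyl in the dual space describes the cone of functionals by finitely many `φ`. By reflexivity
  -- these are vectors of `E`, and they generate `C`.
  obtain ⟨t, ht⟩ := FG.dualFG (C := hull ℝ (s : Set (Dual ℝ E))) ⟨s, rfl⟩
  let ev := Module.evalEquiv ℝ E
  have hmem : ∀ g : Dual ℝ E, g ∈ hull ℝ (s : Set (Dual ℝ E)) ↔ ∀ φ ∈ t, 0 ≤ g (ev.symm φ) := by
    intro g
    rw [← ht]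
    refine forall₂_congr fun φ _ => ?_
    rw [Module.apply_evalEquiv_symm_apply]; rfl
  obtain ⟨u, hu⟩ := FG.dualFG (C := hull ℝ ((t.image ev.symm : Finset E) : Set E)) ⟨_, rfl⟩
  refine ⟨t.image ev.symm, le_antisymm ?_ ?_⟩
  · refine Submodule.span_le.2 fun z hz g hg => ?_
    obtain ⟨φ, hφ, rfl⟩ := Finset.mem_image.1 (Finset.mem_coe.1 hz)
    exact (hmem g).1 (subset_hull hg) φ hφ
  · intro z hz
    change z ∈ hull ℝ _
    rw [← hu]
    intro g hg
    have hg' : g ∈ hull ℝ (s : Set (Dual ℝ E)) := by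
      rw [hmem]
      intro φ hφ
      have : ev.symm φ ∈ hull ℝ ((t.image ev.symm : Finset E) : Set E) :=
        subset_hull (Finset.mem_coe.2 (Finset.mem_image_of_mem _ hφ))
      rw [← hu] at this
      exact this hg
    rw [← dual_hull] at hz
    exact hz hg'

theorem DualFG.comap {C : PointedCone ℝ E'} (hC : C.DualFG (LinearMap.id (M := Dual ℝ E')))
    (L : E →ₗ[ℝ] E') : (C.comap L).DualFG (LinearMap.id (M := Dual ℝ E)) := by
  classical
  obtain ⟨s, rfl⟩ := hC
  refine ⟨s.image (fun f => f ∘ₗ L), ?_⟩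
  ext z
  simp

theorem DualFG.iInf {ι : Type*} [Finite ι] {C : ι → PointedCone ℝ E}
    (hC : ∀ i, (C i).DualFG (LinearMap.id (M := Dual ℝ E))) :
    (⨅ i, C i).DualFG (LinearMap.id (M := Dual ℝ E)) := by
  classical
  have := Fintype.ofFinite ι
  choose s hs using hC
  refine ⟨Finset.univ.biUnion s, ?_⟩
  simp [← hs, dual_iUnion]

theorem DualFG.halfspace (f : Dual ℝ E) :
    ((positive ℝ ℝ).comap f).DualFG (LinearMap.id (M := Dual ℝ E)) :=
  ⟨{f}, by simp [dual_singleton]⟩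

/-- A linear functional that is nonnegative on the recession cone of a nonempty polyhedron, given
as the slice at height `1` of a polyhedral cone, attains its minimum. -/
theorem exists_forall_le_slice_of_fg {H : PointedCone ℝ (E × ℝ)} (hH : H.FG)
    (hnn : ∀ p ∈ H, 0 ≤ p.2) (hne : ∃ z, (z, (1 : ℝ)) ∈ H) (c : Dual ℝ E)
    (hc : ∀ d, (d, (0 : ℝ)) ∈ H → 0 ≤ c d) :
    ∃ z, (z, (1 : ℝ)) ∈ H ∧ ∀ z', (z', (1 : ℝ)) ∈ H → c z ≤ c z' := by
  classical
  obtain ⟨s, rfl⟩ := hH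
  have hs : ∀ p ∈ s, p ∈ hull ℝ (s : Set (E × ℝ)) := fun p hp => subset_hull hp
  have hpos : (s.filter (fun p => 0 < p.2)).Nonempty := by
    by_contra hempty
    rw [Finset.not_nonempty_iff_eq_empty] at hempty
    obtain ⟨z, hz⟩ := hne
    have h0 : ∀ p ∈ hull ℝ (s : Set (E × ℝ)), -p.2 ∈ positive ℝ ℝ := by
      intro p hp
      have : hull ℝ (s : Set (E × ℝ)) ≤ (positive ℝ ℝ).comap (-LinearMap.snd ℝ E ℝ) := by
        refine Submodule.span_le.2 fun p hp => ?_
        have : ¬ 0 < p.2 := fun h => by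
          have : p ∈ s.filter (fun p => 0 < p.2) := Finset.mem_filter.2 ⟨hp, h⟩
          simp [hempty] at this
        simpa using this
      exact this hp
    have := h0 _ hz
    norm_num at this
  -- With `m` the least ratio, `c - m * height` is nonnegative on all generators, hence on the cone;
  -- at height 1 this says `m ≤ c`.
  obtain ⟨p, hp, hmin⟩ := Finset.exists_min_image _ (fun p : E × ℝ => c p.1 / p.2) hpos
  obtain ⟨hps, hp2⟩ := Finset.mem_filter.1 hp
  refine ⟨p.2⁻¹ • p.1, ?_, fun z' hz' => ?_⟩
  · have := (hull ℝ (s : Set (E × ℝ))).smul_mem (inv_nonneg.2 hp2.le) (hs p hps)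
    convert this using 1
    ext
    · rfl
    · simp [inv_mul_cancel₀ hp2.ne']
  · have : hull ℝ (s : Set (E × ℝ)) ≤ (positive ℝ ℝ).comap
        (c ∘ₗ LinearMap.fst ℝ E ℝ - (c p.1 / p.2) • LinearMap.snd ℝ E ℝ) := by
      refine Submodule.span_le.2 fun r hr => ?_
      have : c p.1 / p.2 * r.2 ≤ c r.1 := by
        rcases (hnn r (hs r hr)).eq_or_lt with h0 | h0
        · rw [← h0, mul_zero]
          have hr0 : r = (r.1, 0) := Prod.ext rfl h0.symm
          exact hc _ (hr0 ▸ hs r hr)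
        · rw [← le_div_iff₀ h0]
          exact hmin r (Finset.mem_filter.2 ⟨hr, h0⟩)
      simpa using this
    have := this hz'
    simp only [mem_comap, LinearMap.sub_apply, LinearMap.comp_apply, LinearMap.fst_apply,
      LinearMap.smul_apply, LinearMap.snd_apply, smul_eq_mul, mul_one, mem_positive,
      sub_nonneg] at this
    rw [map_smul, smul_eq_mul, inv_mul_eq_div]
    exact this

theorem DualFG.exists_forall_le_slice [FiniteDimensional ℝ E] {H : PointedCone ℝ (E × ℝ)}
    (hH : H.DualFG (LinearMap.id (M := Dual ℝ (E × ℝ)))) (hne : ∃ z, (z, (1 : ℝ)) ∈ H)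
    (c : Dual ℝ E) (hc : ∀ d, (d, (0 : ℝ)) ∈ H → 0 ≤ c d) :
    ∃ z, (z, (1 : ℝ)) ∈ H ∧ ∀ z', (z', (1 : ℝ)) ∈ H → c z ≤ c z' := by
  have h1 : ∀ z, (z, (1 : ℝ)) ∈ H → (z, (1 : ℝ)) ∈
      H ⊓ (positive ℝ ℝ).comap (LinearMap.snd ℝ E ℝ) := fun z hz => ⟨hz, by simp⟩
  obtain ⟨z, hz, hmin⟩ := exists_forall_le_slice_of_fg
    (hH.inf (DualFG.halfspace (LinearMap.snd ℝ E ℝ))).fg (fun p hp => by simpa using hp.2) (hne.imp h1) c (fun d hd => hc d hd.1)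
  exact ⟨z, hz.1, fun z' hz' => hmin z' (h1 z' hz')⟩

end PointedCone

/-! ### Maximal values by linear programming. -/

namespace SetOpt

open Module PointedCone

section Maximal

variable {X Y : Type*} [AddCommGroup X] [Module ℝ X]
  [AddCommGroup Y] [Module ℝ Y] [FiniteDimensional ℝ Y]

/-- The graph of `F + C`, homogenized, is a polyhedral cone. -/
theorem exists_finset_iff_mem_add [FiniteDimensional ℝ X]
    {H : PointedCone ℝ ((X × Y) × ℝ)} {C : PointedCone ℝ Y}
    (hH : H.DualFG (LinearMap.id (M := Dual ℝ ((X × Y) × ℝ))))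
    (hC : C.DualFG (LinearMap.id (M := Dual ℝ Y))) :
    ∃ W : Finset (Dual ℝ ((X × Y) × ℝ)), ∀ x y t,
      (∀ w ∈ W, 0 ≤ w ((x, y), t)) ↔ ∃ y', ((x, y'), t) ∈ H ∧ ∃ c ∈ C, y' + c = y := by
  let ι : Y →ₗ[ℝ] (X × Y) × ℝ := LinearMap.inl ℝ (X × Y) ℝ ∘ₗ LinearMap.inr ℝ X Y
  -- Adding `C` in the `y` coordinate is a sum of finitely generated cones, so Weyl applies.
  obtain ⟨W, hW⟩ := PointedCone.FG.dualFG (C := H ⊔ C.map ι)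
    (Submodule.FG.sup hH.fg (Submodule.FG.map _ hC.fg))
  refine ⟨W, fun x y t => ?_⟩
  have h1 : (∀ w ∈ W, 0 ≤ w ((x, y), t)) ↔ ((x, y), t) ∈ H ⊔ C.map ι := by
    rw [← hW]; exact Iff.rfl
  rw [h1, Submodule.mem_sup]
  constructor
  · rintro ⟨⟨⟨x', y'⟩, t'⟩, h', z, hz, hsum⟩
    obtain ⟨c, hc, rfl⟩ := PointedCone.mem_map.1 hz
    simp only [ι, LinearMap.comp_apply, LinearMap.inl_apply, LinearMap.inr_apply, Prod.mk_add_mk,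
      add_zero, Prod.mk.injEq] at hsum
    obtain ⟨⟨rfl, rfl⟩, rfl⟩ := hsum
    exact ⟨y', h', c, hc, rfl⟩
  · rintro ⟨y', h', c, hc, rfl⟩
    exact ⟨_, h', _, PointedCone.mem_map.2 ⟨c, hc, rfl⟩, by simp [ι]⟩

/-- A functional that is nonnegative on the recession cone of a nonempty value of a polyhedral
map attains its minimum there. -/
theorem exists_forall_le_fiber {H : PointedCone ℝ ((X × Y) × ℝ)}
    (hH : H.DualFG (LinearMap.id (M := Dual ℝ ((X × Y) × ℝ)))) {x : X}
    (hne : ∃ y, ((x, y), (1 : ℝ)) ∈ H) (c : Dual ℝ Y)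
    (hc : ∀ d, (((0 : X), d), (0 : ℝ)) ∈ H → 0 ≤ c d) :
    ∃ y, ((x, y), (1 : ℝ)) ∈ H ∧ ∀ y', ((x, y'), (1 : ℝ)) ∈ H → c y ≤ c y' := by
  -- `(y, t) ↦ ((t • x, y), t)`: height 1 gives the value at `x`, height 0 the recession value at 0.
  let L : Y × ℝ →ₗ[ℝ] (X × Y) × ℝ :=
    ((LinearMap.toSpanSingleton ℝ X x ∘ₗ LinearMap.snd ℝ Y ℝ).prod (LinearMap.fst ℝ Y ℝ)).prod
      (LinearMap.snd ℝ Y ℝ)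
  simpa [L] using (hH.comap L).exists_forall_le_slice (by simpa [L] using hne) c
    (by simpa [L] using hc)

/-- If recession directions `u` with `0 ∈ G u + C` satisfy `G u ⊆ C`, then every value of `F + C`
is contained in a maximal one. -/
theorem exists_maximal_value [FiniteDimensional ℝ X] {F G : X → Set Y}
    {H : PointedCone ℝ ((X × Y) × ℝ)} {C : PointedCone ℝ Y} (hH : H.DualFG (LinearMap.id (M := Dual ℝ ((X × Y) × ℝ))))
    (hF : ∀ x y, y ∈ F x ↔ ((x, y), (1 : ℝ)) ∈ H) (hG : ∀ x y, y ∈ G x ↔ ((x, y), (0 : ℝ)) ∈ H)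
    (hC : C.DualFG (LinearMap.id (M := Dual ℝ Y)))
    (hGC : ∀ u, ∀ y ∈ G u, 0 ∈ G u + (C : Set Y) → y ∈ C) {x₀ : X} (hx₀ : (F x₀).Nonempty) :
    ∃ x, F x₀ + (C : Set Y) ⊆ F x + C ∧ ¬ ∃ x', F x + (C : Set Y) ⊂ F x' + C := by
  classical
  obtain ⟨W, hW⟩ := exists_finset_iff_mem_add hH hC
  have hFC : ∀ x y, y ∈ F x + (C : Set Y) ↔ ∀ w ∈ W, 0 ≤ w ((x, y), (1 : ℝ)) := by
    intro x y; simp only [hW, Set.mem_add, hF, SetLike.mem_coe]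
  have hG0 : ∀ u, 0 ∈ G u + (C : Set Y) ↔ ∀ w ∈ W, 0 ≤ w ((u, 0), (0 : ℝ)) := by
    intro u; simp only [hW, Set.mem_add, hG, SetLike.mem_coe]
  -- For fixed `x`, each `w` is a lower bound on `η w y`, so `F x + C` is determined by the minima
  -- of the `η w`.
  let η : Dual ℝ ((X × Y) × ℝ) → Dual ℝ Y :=
    fun w => w ∘ₗ LinearMap.inl ℝ (X × Y) ℝ ∘ₗ LinearMap.inr ℝ X Y
  have hη : ∀ (w : Dual ℝ ((X × Y) × ℝ)) x y y' t,
      w ((x, y), t) - η w y = w ((x, y'), t) - η w y' := by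
    intro w x y y' t
    simp only [η, LinearMap.comp_apply, ← map_sub]
    simp
  have h00 : (0 : Y) ∈ G 0 := (hG 0 0).2 H.zero_mem
  have hG0C : ∀ y ∈ G 0, y ∈ C := fun y hy => hGC 0 y hy ⟨0, h00, 0, C.zero_mem, add_zero 0⟩
  have hηC : ∀ w ∈ W, ∀ c ∈ C, 0 ≤ η w c := fun w hw c hc =>
    (hW 0 c 0).2 ⟨0, H.zero_mem, c, hc, zero_add c⟩ w hw
  have hfib : ∀ x, (F x).Nonempty → ∃ ys : W → Y, ∀ w : W, ys w ∈ F x ∧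
      ∀ y ∈ F x + (C : Set Y), η w (ys w) ≤ η w y := by
    intro x hx
    have : ∀ w : W, ∃ y, y ∈ F x ∧ ∀ y' ∈ F x + (C : Set Y), η w y ≤ η w y' := by
      intro w
      obtain ⟨y, hy, hmin⟩ := exists_forall_le_fiber hH (hx.imp fun y => (hF x y).1) (η w)
        (fun d hd => hηC w w.2 d (hG0C d ((hG 0 d).2 hd)))
      refine ⟨y, (hF x y).2 hy, ?_⟩
      rintro _ ⟨y', hy', c, hc, rfl⟩
      have h1 := hmin y' ((hF x y').1 hy')
      have h2 := hηC w w.2 c hc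
      change _ ≤ η w (y' + c)
      rw [map_add]; linarith
    choose ys hys using this
    exact ⟨ys, hys⟩
  obtain ⟨y₀, hy₀⟩ := hfib x₀ hx₀
  -- The program chooses `x` and points `ys w ∈ F x` with `η w (ys w)` at most the minimum over `F
  -- x₀`, and minimizes the sum of these numbers.
  let A : W → ((X × (W → Y)) × ℝ →ₗ[ℝ] (X × Y) × ℝ) := fun w =>
    (LinearMap.id.prodMap (LinearMap.proj w)).prodMap LinearMap.id
  let B : W → Dual ℝ ((X × (W → Y)) × ℝ) := fun w =>
    (η w (y₀ w)) • LinearMap.snd ℝ _ ℝ -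
      η w ∘ₗ LinearMap.proj w ∘ₗ LinearMap.snd ℝ X (W → Y) ∘ₗ LinearMap.fst ℝ _ ℝ
  let P : PointedCone ℝ ((X × (W → Y)) × ℝ) :=
    (⨅ w, H.comap (A w)) ⊓ ⨅ w, (positive ℝ ℝ).comap (B w)
  have hP : ∀ x ys t, ((x, ys), t) ∈ P ↔
      ∀ w, ((x, ys w), t) ∈ H ∧ η w (ys w) ≤ t * η w (y₀ w) := by
    intro x ys t
    simp only [P, A, B, Submodule.mem_inf, Submodule.mem_iInf, mem_comap, mem_positive,
      forall_and]
    simp [mul_comm]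
  have hPfg : P.DualFG (LinearMap.id (M := Dual ℝ ((X × (W → Y)) × ℝ))) :=
    (DualFG.iInf fun w => hH.comap (A w)).inf (DualFG.iInf fun w => DualFG.halfspace (B w))
  let obj : Dual ℝ (X × (W → Y)) :=
    ∑ w : W, η w ∘ₗ LinearMap.proj w ∘ₗ LinearMap.snd ℝ X (W → Y)
  have hobj : ∀ x ys, obj (x, ys) = ∑ w : W, η w (ys w) := by
    intro x ys; simp [obj, LinearMap.sum_apply]
  obtain ⟨⟨x, ys⟩, hxys, hmin⟩ := hPfg.exists_forall_le_slice
    ⟨(x₀, y₀), (hP _ _ _).2 fun w => ⟨(hF _ _).1 (hy₀ w).1, by simp⟩⟩ obj (by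
      rintro ⟨u, gs⟩ hd
      rw [hP] at hd
      -- Along a recession direction `η w (gs w) ≤ 0`, so 0 also satisfies every inequality
      -- describing `G u + C`.
      have hu : 0 ∈ G u + (C : Set Y) := by
        rw [hG0]
        intro w hw
        obtain ⟨h1, h2⟩ := hd ⟨w, hw⟩
        have h3 := (hW u (gs ⟨w, hw⟩) 0).2 ⟨_, h1, 0, C.zero_mem, add_zero _⟩ w hw
        have h4 := hη w u (gs ⟨w, hw⟩) 0 0
        rw [map_zero] at h4
        simp only at h2
        linarith
      rw [hobj]
      exact Finset.sum_nonneg fun w _ =>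
        hηC w w.2 _ (hGC u _ ((hG _ _).2 (hd w).1) hu))
  rw [hP] at hxys
  have hysF : ∀ w, ys w ∈ F x := fun w => (hF _ _).2 (hxys w).1
  have hsub : F x₀ + (C : Set Y) ⊆ F x + C := by
    intro y hy
    rw [hFC]
    intro w hw
    have h1 := (hFC x (ys ⟨w, hw⟩)).1 ⟨_, hysF ⟨w, hw⟩, 0, C.zero_mem, add_zero _⟩ w hw
    have h2 := (hy₀ ⟨w, hw⟩).2 y hy
    have h3 := (hxys ⟨w, hw⟩).2
    have h4 := hη w x y (ys ⟨w, hw⟩) 1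
    simp only at h2 h3
    linarith
  refine ⟨x, hsub, ?_⟩
  rintro ⟨x', hss⟩
  refine hss.2 ?_
  have hx' : (F x').Nonempty := by
    obtain ⟨y, hy⟩ := hx₀
    obtain ⟨y', hy', -⟩ := hss.1 (hsub ⟨y, hy, 0, C.zero_mem, add_zero _⟩)
    exact ⟨y', hy'⟩
  obtain ⟨ys', hys'⟩ := hfib x' hx'
  -- A larger value has smaller or equal minima; optimality of the sum forces equality in each.
  have hle : ∀ w : W, η w (ys' w) ≤ η w (ys w) := fun w =>
    (hys' w).2 _ (hss.1 ⟨_, hysF w, 0, C.zero_mem, add_zero _⟩)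
  have hsum := hmin (x', ys') ((hP _ _ _).2 fun w =>
    ⟨(hF _ _).1 (hys' w).1, (hle w).trans (hxys w).2⟩)
  rw [hobj, hobj] at hsum
  have heq : ∀ w : W, η w (ys w) ≤ η w (ys' w) := by
    have := (Finset.sum_eq_sum_iff_of_le (fun w _ => hle w)).1
      (le_antisymm (Finset.sum_le_sum fun w _ => hle w) hsum)
    exact fun w => (this w (Finset.mem_univ w)).ge
  intro y hy
  rw [hFC]
  intro w hw
  have h1 := (hFC x (ys ⟨w, hw⟩)).1 ⟨_, hysF ⟨w, hw⟩, 0, C.zero_mem, add_zero _⟩ w hw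
  have h2 := (hys' ⟨w, hw⟩).2 y hy
  have h3 := heq ⟨w, hw⟩
  have h4 := hη w x y (ys ⟨w, hw⟩) 1
  simp only at h2 h3
  linarith

end Maximal

end SetOpt

/-! ### Homogenization, necessity of (*), and construction of a solution. -/

namespace SetOpt

open Module PointedCone

variable {n q : ℕ} {F : (Fin n → ℝ) → Set (Fin q → ℝ)}

/-- The homogenization of a polyhedral convex map. -/
theorem IsPolyhedralConvexMap.exists_homogenization (hF : IsPolyhedralConvexMap F) :
    ∃ H : PointedCone ℝ (((Fin n → ℝ) × (Fin q → ℝ)) × ℝ),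
      H.DualFG (LinearMap.id (M := Dual ℝ (((Fin n → ℝ) × (Fin q → ℝ)) × ℝ))) ∧
      (∀ p ∈ H, 0 ≤ p.2) ∧ (∀ x y, y ∈ F x ↔ ((x, y), (1 : ℝ)) ∈ H) ∧
      (IsFeasible F → ∀ x y, y ∈ recessionMap F x ↔ ((x, y), (0 : ℝ)) ∈ H) := by
  obtain ⟨m, f, b, hf⟩ := hF
  let row : Fin m → Dual ℝ (((Fin n → ℝ) × (Fin q → ℝ)) × ℝ) := fun i =>
    f i ∘ₗ LinearMap.fst ℝ _ ℝ - b i • LinearMap.snd ℝ _ ℝ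
  let H : PointedCone ℝ (((Fin n → ℝ) × (Fin q → ℝ)) × ℝ) :=
    (⨅ i, (positive ℝ ℝ).comap (row i)) ⊓ (positive ℝ ℝ).comap (LinearMap.snd ℝ _ ℝ)
  have hH : ∀ z t, (z, t) ∈ H ↔ (∀ i, t * b i ≤ f i z) ∧ 0 ≤ t := by
    intro z t
    simp only [H, row, Submodule.mem_inf, Submodule.mem_iInf, mem_comap, mem_positive]
    simp [mul_comm]
  have hgr : ∀ z, z ∈ graph F ↔ ∀ i, b i ≤ f i z := fun z => by rw [hf]; rfl
  refine ⟨H, (DualFG.iInf fun i => DualFG.halfspace _).inf (DualFG.halfspace _),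
    fun p hp => ((hH p.1 p.2).1 hp).2, fun x y => ?_, ?_⟩
  · rw [hH]
    simpa [graph] using hgr (x, y)
  -- A base point is needed: the recession cone of an empty graph is the whole space.
  · rintro ⟨x₀, y₀, h₀⟩ x y
    rw [hH]
    simp only [zero_mul, le_refl, and_true]
    constructor
    · intro h i
      have hz : (x₀, y₀) ∈ graph F := h₀
      by_contra hneg
      push Not at hneg
      set a := f i (x₀, y₀) with ha
      have hba : b i ≤ a := (hgr _).1 hz i
      have h1 := (hgr _).1 (h _ hz ((a - b i + 1) / (-f i (x, y)))
        (div_nonneg (by linarith) (by linarith))) i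
      rw [map_add, map_smul, smul_eq_mul, ← ha, div_mul_eq_mul_div, mul_div_assoc,
        div_neg, div_self hneg.ne] at h1
      linarith
    · intro h z hz t ht
      rw [hgr] at hz ⊢
      intro i
      rw [map_add, map_smul, smul_eq_mul]
      linarith [hz i, mul_nonneg ht (h i)]

theorem IsPolyhedralConvexCone.exists_pointedCone {E : Type*} [AddCommGroup E] [Module ℝ E]
    {C : Set E} (hC : IsPolyhedralConvexCone C) :
    ∃ D : PointedCone ℝ E, D.DualFG (LinearMap.id (M := Dual ℝ E)) ∧ (D : Set E) = C := by
  obtain ⟨m, f, rfl⟩ := hC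
  refine ⟨⨅ i, (positive ℝ ℝ).comap (f i), DualFG.iInf fun i => DualFG.halfspace _, ?_⟩
  ext z
  simp

theorem add_mem_of_mem_recessionMap {x u : Fin n → ℝ} {y g : Fin q → ℝ} (hy : y ∈ F x)
    (hg : g ∈ recessionMap F u) {t : ℝ} (ht : 0 ≤ t) : y + t • g ∈ F (x + t • u) :=
  hg (x, y) hy t ht

theorem add_mem_recessionMap {u v : Fin n → ℝ} {g h : Fin q → ℝ} (hg : g ∈ recessionMap F u)
    (hh : h ∈ recessionMap F v) : g + h ∈ recessionMap F (u + v) := by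
  intro z hz t ht
  have := hh _ (hg z hz t ht) t ht
  rwa [add_assoc, ← smul_add] at this

/-- Existence of a minimizing point forces `G u ⊆ C` whenever `0 ∈ G u + C`. -/
theorem IsMinimizingPoint.mem_of_zero_mem {C : PointedCone ℝ (Fin q → ℝ)}
    (hF : IsPolyhedralConvexMap F) (hC : C.DualFG (LinearMap.id (M := Dual ℝ (Fin q → ℝ))))
    (hG0 : recessionMap F 0 ⊆ C) {xbar : Fin n → ℝ} (hx : IsMinimizingPoint F C xbar)
    {u : Fin n → ℝ} {y : Fin q → ℝ} (hy : y ∈ recessionMap F u)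
    (hu : 0 ∈ recessionMap F u + (C : Set (Fin q → ℝ))) : y ∈ C := by
  obtain ⟨H, hH, -, hFH, hGH⟩ := hF.exists_homogenization
  obtain ⟨hxd, hmax⟩ := hx
  have hGH := hGH ⟨xbar, hxd⟩
  obtain ⟨v, hv⟩ := hxd
  obtain ⟨g, hg, c, hc, hgc⟩ := hu
  have hsub : ∀ t : ℝ, 0 ≤ t → F xbar + (C : Set (Fin q → ℝ)) ⊆ F (xbar + t • u) + C := by
    rintro t ht _ ⟨w, hw, c', hc', rfl⟩
    refine ⟨w + t • g, add_mem_of_mem_recessionMap hw hg ht, t • c + c',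
      C.add_mem (C.smul_mem ht hc) hc', ?_⟩
    have : t • g + t • c = 0 := by rw [← smul_add]; simp only at hgc; rw [hgc, smul_zero]
    calc w + t • g + (t • c + c') = w + (t • g + t • c) + c' := by abel
      _ = w + c' := by rw [this, add_zero]
  have hray : ∀ t : ℝ, 0 ≤ t → v + t • y ∈ F xbar + (C : Set (Fin q → ℝ)) := by
    intro t ht
    by_contra hn
    exact hmax ⟨xbar + t • u, hsub t ht, fun h => hn (h ⟨_, add_mem_of_mem_recessionMap hv hy ht,
      0, C.zero_mem, add_zero _⟩)⟩
  obtain ⟨s, rfl⟩ := hC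
  intro f hf
  have hfC : ∀ c ∈ dual (LinearMap.id (M := Dual ℝ (Fin q → ℝ))) (s : Set (Dual ℝ (Fin q → ℝ))),
    0 ≤ f c := fun c hc => hc hf
  obtain ⟨y₀, -, hmin⟩ := exists_forall_le_fiber hH ⟨v, (hFH _ _).1 hv⟩ f
    (fun d hd => hfC d (hG0 ((hGH 0 d).2 hd)))
  change 0 ≤ f y
  by_contra hneg
  push Not at hneg
  have h0 : f y₀ ≤ f v := hmin v ((hFH _ _).1 hv)
  -- At this parameter `f` equals `f y₀ - 1` on the ray, below its minimum over `F xbar + C`.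
  obtain ⟨w, hw, c', hc', hwc⟩ := hray ((f v - f y₀ + 1) / (-f y))
    (div_nonneg (by linarith) (by linarith))
  have h1 := congrArg f hwc
  simp only [map_add, map_smul, smul_eq_mul] at h1
  rw [div_mul_eq_mul_div, mul_div_assoc, div_neg, div_self hneg.ne] at h1
  linarith [hmin w ((hFH _ _).1 hw), hfC c' hc']

theorem nonempty_of_add_subset_add {Y : Type*} [Add Y] {A B C D : Set Y} (hA : A.Nonempty)
    (hC : C.Nonempty) (h : A + C ⊆ B + D) : B.Nonempty :=
  Set.Nonempty.of_add_left ((hA.add hC).mono h)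

/-- Replacing the generators of the graph of `F` by minimizing points and directions yields a
solution. -/
theorem hasSolution_of_forall_mem {C : PointedCone ℝ (Fin q → ℝ)}
    (hF : IsPolyhedralConvexMap F) (hC : C.DualFG (LinearMap.id (M := Dual ℝ (Fin q → ℝ))))
    (hfeas : IsFeasible F) (hGC : ∀ u, ∀ y ∈ recessionMap F u,
      0 ∈ recessionMap F u + (C : Set (Fin q → ℝ)) → y ∈ C) : HasSolution F C := by
  classical
  obtain ⟨H, hH, hnn, hFH, hGH⟩ := hF.exists_homogenization
  have hGH := hGH hfeas
  have hmaxF := fun x (hx : (F x).Nonempty) => exists_maximal_value hH hFH hGH hC hGC hx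
  -- Resetting the height to 0 makes every slice the graph of `G`, so `G` serves as its own
  -- recession mapping.
  let L : ((Fin n → ℝ) × (Fin q → ℝ)) × ℝ →ₗ[ℝ] ((Fin n → ℝ) × (Fin q → ℝ)) × ℝ :=
    LinearMap.inl ℝ _ ℝ ∘ₗ LinearMap.fst ℝ _ ℝ
  have hL : ∀ t x y, y ∈ recessionMap F x ↔ ((x, y), t) ∈ H.comap L := by
    intro t x y; simp [L, hGH]
  have hmaxG := fun x (hx : (recessionMap F x).Nonempty) =>
    exists_maximal_value (hH.comap L) (hL 1) (hL 0) hC hGC hx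
  have hG0C : ∀ y ∈ recessionMap F 0, y ∈ C := fun y hy =>
    hGC 0 y hy ⟨0, (hGH 0 0).2 H.zero_mem, 0, C.zero_mem, add_zero 0⟩
  have hCne : (C : Set (Fin q → ℝ)).Nonempty := ⟨0, C.zero_mem⟩
  choose! φ hφ hφmax using hmaxF
  choose! ψ hψ hψmax using hmaxG
  obtain ⟨s, hs⟩ := hH.fg
  have hsH : ∀ p ∈ s, p ∈ H := fun p hp => hs ▸ subset_hull hp
  have hpt : ∀ p ∈ s, 0 < p.2 → p.2⁻¹ • p.1.2 ∈ F (p.2⁻¹ • p.1.1) := by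
    intro p hp hp2
    rw [hFH]
    have := H.smul_mem (inv_nonneg.2 hp2.le) (hsH p hp)
    convert this using 1
    ext
    · rfl
    · rfl
    · simp [inv_mul_cancel₀ hp2.ne']
  have hdir : ∀ p ∈ s, p.2 = 0 → p.1.2 ∈ recessionMap F p.1.1 := by
    intro p hp hp2
    have h := hsH p hp
    rw [show p = (p.1, 0) from Prod.ext rfl hp2] at h
    exact (hGH _ _).2 h
  obtain ⟨x₀, hx₀⟩ := hfeas
  let Sbar : Finset (Fin n → ℝ) := insert (φ x₀)
    ((s.filter (fun p => 0 < p.2)).image fun p => φ (p.2⁻¹ • p.1.1))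
  -- Dropping the direction 0 loses nothing, since `C` absorbs `G 0`.
  let Shat : Finset (Fin n → ℝ) :=
    ((s.filter (fun p => p.2 = 0)).image fun p => ψ p.1.1).filter (fun x => x ≠ 0)
  have hSbar : ∀ x ∈ Sbar, IsMinimizingPoint F C x := by
    intro x hx
    rcases Finset.mem_insert.1 hx with rfl | hx
    · exact ⟨nonempty_of_add_subset_add hx₀ hCne (hφ x₀ hx₀), hφmax x₀ hx₀⟩
    · obtain ⟨p, hp, rfl⟩ := Finset.mem_image.1 hx
      have hne : (F (p.2⁻¹ • p.1.1)).Nonempty :=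
        ⟨_, hpt p (Finset.mem_filter.1 hp).1 (Finset.mem_filter.1 hp).2⟩
      exact ⟨nonempty_of_add_subset_add hne hCne (hφ _ hne), hφmax _ hne⟩
  have hShat : ∀ x ∈ Shat, IsMinimizingDirection F C x := by
    intro x hx
    obtain ⟨hx, hx0⟩ := Finset.mem_filter.1 hx
    obtain ⟨p, hp, rfl⟩ := Finset.mem_image.1 hx
    have hne : (recessionMap F p.1.1).Nonempty :=
      ⟨_, hdir p (Finset.mem_filter.1 hp).1 (Finset.mem_filter.1 hp).2⟩
    exact ⟨hx0, nonempty_of_add_subset_add hne hCne (hψ _ hne), hψmax _ hne⟩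
  refine ⟨Sbar, Shat, ⟨Sbar.finite_toSet, Shat.finite_toSet, fun x hx => (hSbar x hx).1,
    ⟨φ x₀, Finset.mem_insert_self _ _⟩, fun x hx => ⟨(hShat x hx).2.1, (hShat x hx).1⟩, ?_⟩,
    hSbar, hShat⟩
  set V : Set (Fin q → ℝ) := convexHull ℝ (⋃ x ∈ (Sbar : Set (Fin n → ℝ)), F x) with hV
  set R : PointedCone ℝ (Fin q → ℝ) :=
    hull ℝ (⋃ x ∈ (Shat : Set (Fin n → ℝ)), recessionMap F x) with hR
  have hFV : ∀ x ∈ Sbar, F x ⊆ V := fun x hx =>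
    (Set.subset_biUnion_of_mem (u := F) (Finset.mem_coe.2 hx)).trans (subset_convexHull ℝ _)
  have hGR : ∀ x ∈ Shat, recessionMap F x ⊆ R := fun x hx =>
    (Set.subset_biUnion_of_mem (u := recessionMap F) (Finset.mem_coe.2 hx)).trans subset_hull
  have hVconv : Convex ℝ V := convex_convexHull ℝ _
  obtain ⟨v₀, hv₀⟩ : V.Nonempty := by
    obtain ⟨y, hy⟩ := (hSbar _ (Finset.mem_insert_self _ _)).1
    exact ⟨y, hFV _ (Finset.mem_insert_self _ _) hy⟩
  -- Weighting `v` by the height makes the inclusion homogeneous, so it passes from generators to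
  -- the cone; sums use `(a + b) • V = a • V + b • V` for convex `V`.
  have key : ∀ p ∈ hull ℝ (s : Set (((Fin n → ℝ) × (Fin q → ℝ)) × ℝ)),
      ∃ c ∈ C, ∃ v ∈ V, ∃ r ∈ R, p.1.2 = c + p.2 • v + r := by
    intro p hp
    have hpH : p ∈ H := hs ▸ hp
    induction hp using Submodule.span_induction with
    | mem p hp =>
      rcases (hnn p hpH).eq_or_lt with h0 | h0
      · have hmem := hdir p hp h0.symm
        have hne : (recessionMap F p.1.1).Nonempty := ⟨_, hmem⟩
        obtain ⟨g, hg, c, hc, hgc⟩ := hψ _ hne ⟨_, hmem, 0, C.zero_mem, add_zero _⟩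
        rw [← h0]
        by_cases hz : ψ p.1.1 = 0
        · rw [hz] at hg
          refine ⟨g + c, C.add_mem (hG0C g hg) hc, v₀, hv₀, 0, R.zero_mem, ?_⟩
          simpa using hgc.symm
        · refine ⟨c, hc, v₀, hv₀, g, hGR _ ?_ hg, ?_⟩
          · exact Finset.mem_filter.2 ⟨Finset.mem_image.2
              ⟨p, Finset.mem_filter.2 ⟨hp, h0.symm⟩, rfl⟩, hz⟩
          · simpa [add_comm] using hgc.symm
      · have hmem := hpt p hp h0
        have hne : (F (p.2⁻¹ • p.1.1)).Nonempty := ⟨_, hmem⟩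
        obtain ⟨y, hy, c, hc, hyc⟩ := hφ _ hne ⟨_, hmem, 0, C.zero_mem, add_zero _⟩
        refine ⟨p.2 • c, C.smul_mem h0.le hc, y, hFV _ ?_ hy, 0, R.zero_mem, ?_⟩
        · exact Finset.mem_insert_of_mem (Finset.mem_image.2
            ⟨p, Finset.mem_filter.2 ⟨hp, h0⟩, rfl⟩)
        · simp only at hyc
          rw [add_zero, ← smul_add, add_comm c, hyc, smul_inv_smul₀ h0.ne']
    | zero => exact ⟨0, C.zero_mem, v₀, hv₀, 0, R.zero_mem, by simp⟩
    | add p p' hp hp' ih ih' =>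
      have hpH : p ∈ H := hs ▸ hp
      have hpH' : p' ∈ H := hs ▸ hp'
      obtain ⟨c, hc, v, hv, r, hr, h⟩ := ih hpH
      obtain ⟨c', hc', v', hv', r', hr', h'⟩ := ih' hpH'
      obtain ⟨w, hw, hwv⟩ : ∃ w ∈ V, (p.2 + p'.2) • w = p.2 • v + p'.2 • v' := by
        have := hVconv.add_smul (hnn p hpH) (hnn p' hpH')
        have hmem : p.2 • v + p'.2 • v' ∈ p.2 • V + p'.2 • V :=
          Set.add_mem_add (Set.smul_mem_smul_set hv) (Set.smul_mem_smul_set hv')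
        rw [← this] at hmem
        exact Set.mem_smul_set.1 hmem
      refine ⟨c + c', C.add_mem hc hc', w, hw, r + r', R.add_mem hr hr', ?_⟩
      rw [Prod.snd_add, Prod.fst_add, Prod.snd_add, hwv, h, h']
      abel
    | smul a p hp ih =>
      obtain ⟨c, hc, v, hv, r, hr, h⟩ := ih (hs ▸ hp)
      refine ⟨a • c, C.smul_mem a.2 hc, v, hv, a • r, R.smul_mem a.2 hr, ?_⟩
      rw [Prod.smul_snd, Prod.smul_fst, Prod.smul_snd, h, smul_add, smul_add, smul_assoc]
  rintro _ ⟨c, hc, y, hy, rfl⟩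
  obtain ⟨x, hx⟩ := Set.mem_iUnion.1 hy
  obtain ⟨c', hc', v, hv, r, hr, h⟩ := key ((x, y), 1) (hs.ge ((hFH x y).1 hx))
  refine ⟨(c + c') + v, ⟨c + c', C.add_mem hc hc', v, hv, rfl⟩, r, hr, ?_⟩
  simp only [one_smul] at h
  simp only [h]
  abel

end SetOpt

theorem theorem2 (n q : ℕ) (F : (Fin n → ℝ) → Set (Fin q → ℝ)) (C : Set (Fin q → ℝ))
    (hF : SetOpt.IsPolyhedralConvexMap F) (hC : SetOpt.IsPolyhedralConvexCone C)
    (hreg : SetOpt.IsRegular F C) :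
    SetOpt.HasSolution F C ↔
      SetOpt.IsFeasible F ∧
      -C ∩ SetOpt.upperImage (SetOpt.recessionMap F) C ⊆ C ∧
      SetOpt.naturalOrderingCone F ⊆ C := by
  obtain ⟨D, hD, rfl⟩ := hC.exists_pointedCone
  obtain ⟨hlin, hG0⟩ := hreg
  constructor
  · rintro ⟨Sbar, Shat, hinf, hmin, -⟩
    obtain ⟨x, hx⟩ := hinf.points_nonempty
    have hmem : ∀ {u y}, y ∈ SetOpt.recessionMap F u →
        0 ∈ SetOpt.recessionMap F u + (D : Set (Fin q → ℝ)) → y ∈ D :=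
      (hmin x hx).mem_of_zero_mem hF hD hG0
    refine ⟨⟨x, hinf.points_subset hx⟩, ?_, ?_⟩
    · rintro _ ⟨hneg, c, hc, g, hg, rfl⟩
      obtain ⟨u, hu⟩ := Set.mem_iUnion.1 hg
      refine D.add_mem hc (hmem hu ⟨g, hu, -(c + g) + c, D.add_mem hneg hc, ?_⟩)
      simp only
      abel
    · rintro y ⟨u, hy, h0⟩
      exact hmem hy ⟨0, h0, 0, D.zero_mem, add_zero 0⟩
  · rintro ⟨hfeas, hQ, hK⟩
    refine SetOpt.hasSolution_of_forall_mem hF hD hfeas ?_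
    rintro u y hy ⟨g, hg, c, hc, hgc⟩
    obtain rfl : c = -g := eq_neg_of_add_eq_zero_right hgc
    have hgD : g ∈ (D : Set (Fin q → ℝ)) :=
      hQ ⟨hc, 0, D.zero_mem, g, Set.mem_iUnion.2 ⟨u, hg⟩, zero_add g⟩
    have hneg : -g ∈ SetOpt.recessionMap F 0 := hlin ⟨hc, by simpa using hgD⟩
    have h0 := SetOpt.add_mem_recessionMap hg hneg
    rw [add_zero, add_neg_cancel] at h0
    exact hK ⟨u, hy, h0⟩
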